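/- Consider a server with a library of $N_c + G N_u$ files of $B$ bits each and $K$ users in $G \ge 1$ groups of $K/G \ge 1$ users, where $K/G$ is an integer. Each of the $N_c$ common files may be requested by every user; for each group there are $N_u$ unique files, which only the users of that group may request. Assume $N_c \ge K$ and $N_u \ge K/G$. Each user stores at most $MB$ bits copied from the library (uncoded placement), where $0 \le M \le N_c + N_u$. After the demands are revealed, the server broadcasts a message from which, together with its cache, each user must recover the file it requests, for every content of the library. The load is the least possible message length divided by $B$; let $R^\star(M)$ be the infimum, over all $B \ge 1$ and all uncoded placements, of the maximal load over the demand vectors with pairwise distinct requested files. For $\beta \in [0,1]$ and $\alpha \in [0, K/G]$ put $t_c = K\beta M/N_c$, $t_u = K(1-\beta)M/(G N_u)$ and $$R(\beta,\alpha) = \frac{\binom{K}{t_c+1} - \binom{G\alpha}{t_c+1}}{\binom{K}{t_c}} + G\,\frac{\binom{K/G}{t_u+1} - \binom{K/G-\alpha}{t_u+1}}{\binom{K/G}{t_u}},$$ where $\binom{n}{k} = \frac{\Gamma(n+1)}{\Gamma(k+1)\Gamma(n-k+1)}$ for real $n \ge 0$ and $0 \le k < n+1$, and $\binom{n}{k}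 = 0$ otherwise, and where a quotient with denominator $0$ (which occurs only if the numerator is $0$ too) is read as $0$. Then $$\min_{\beta}\max_{\alpha} R(\beta,\alpha) \le 2\,R^\star(M) \qquad \text{for all } 0 \le M \le N_c + N_u .$$ Moreover, $R(\beta,\alpha)$ is achievable by the scheme that separates common and unique files: whenever $\beta \in [0,1]$ is such that $t_c \in \{0,\dots,K\}$ and $t_u \in \{0,\dots,K/G\}$ are integers, there are a $B \ge 1$ and an uncoded placement with memory $M$ which cuts each common file into $\binom{K}{t_c}$ subfiles of equal size, one for each set of $t_c$ users and cached by exactly these users, and each unique file of a group into $\binom{K/G}{t_u}$ subfiles of equal size, one for each set of $t_u$ users of that group and cached by exactly these users, and whose worst-case load over the demand vectors with distinct requests is at most $\max_{\alpha} R(\beta,\alpha)$. In particular $R^\star(M) \le \max_{\alpha} R(\beta,\alpha)$ for every such $\beta$. -/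

import Mathlib

/-!
Coded caching with heterogeneous user profiles.

There are `G` groups of `L` users each (`K = G * L` users in total), `Nc` common files, which every
user may request, and for each group `Nu` unique files, which only the users of that group may
request. Every file has `B` bits and every user has a cache of `M * B` bits.
-/

namespace CodedCaching

/-! ### The caching problem -/

/-- A user is a pair (group, index inside the group). -/
abbrev User (G L : ℕ) : Type := Fin G × Fin L

/-- The files of the library: `Nc` common ones, and `Nu` unique ones for each group. -/
abbrev FileId (G Nc Nu : ℕ) : Type := Fin Nc ⊕ (Fin G × Fin Nu)

/-- A position in the library: a file and a bit position in that file. -/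
abbrev BitPos (G Nc Nu B : ℕ) : Type := FileId G Nc Nu × Fin B

/-- A realization of the library: the content of each of its bits. -/
abbrev Library (G Nc Nu B : ℕ) : Type := BitPos G Nc Nu B → Bool

/-- A demand vector: user `k` asks for common file number `n` (`d k = Sum.inl n`) or for unique
file number `n` of the group of `k` (`d k = Sum.inr n`). -/
abbrev Demand (G L Nc Nu : ℕ) : Type := User G L → Fin Nc ⊕ Fin Nu

/-- The file that user `k` requests. -/
def requested {G L Nc Nu : ℕ} (d : Demand G L Nc Nu) (k : User G L) : FileId G Nc Nu :=
  Sum.map id (fun n => (k.1, n)) (d k)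

/-- The demand vectors with pairwise distinct requested files. -/
abbrev DistinctDemand (G L Nc Nu : ℕ) : Type :=
  {d : Demand G L Nc Nu // Function.Injective (requested d)}

/-- An uncoded placement: every user copies a set of bits of the library. -/
abbrev Placement (G L Nc Nu B : ℕ) : Type := User G L → Finset (BitPos G Nc Nu B)

/-- Every cache holds at most `M * B` bits. -/
def FitsMemory {G L Nc Nu B : ℕ} (χ : Placement G L Nc Nu B) (M : ℝ) : Prop :=
  ∀ k, ((χ k).card : ℝ) ≤ M * B

/-- With placement `χ`, the demand `d` can be served by a message of `ℓ` bits: there are an encoder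
and, for each user, a decoder that recovers the requested file, for every content of the library,
from the message and the content of the cache of that user. -/
def CanServe {G L Nc Nu B : ℕ} (χ : Placement G L Nc Nu B) (d : Demand G L Nc Nu) (ℓ : ℕ) : Prop :=
  ∃ (enc : Library G Nc Nu B → (Fin ℓ → Bool))
    (dec : ∀ k : User G L, (Fin ℓ → Bool) → ({p // p ∈ χ k} → Bool) → (Fin B → Bool)),
    ∀ (W : Library G Nc Nu B) (k : User G L),
      dec k (enc W) (fun p => W p.1) = fun b => W (requested d k, b)

/-- The load of the demand `d` under the placement `χ`: the least length of a message that serves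
`d`, in units of files. (Sending the whole library always serves `d`.) -/
noncomputable def load {G L Nc Nu B : ℕ} (χ : Placement G L Nc Nu B)
    (d : Demand G L Nc Nu) : ℝ :=
  ((sInf {ℓ : ℕ | CanServe χ d ℓ} : ℕ) : ℝ) / B

/-- The worst-case load of a placement, over the demands with distinct requests. -/
noncomputable def worstLoad {G L Nc Nu B : ℕ} (χ : Placement G L Nc Nu B) : ℝ :=
  ⨆ d : DistinctDemand G L Nc Nu, load χ d.1

/-- The optimal worst-case load `R⋆(M)` under uncoded placement, over all file sizes `B ≥ 1`. -/
noncomputable def optimalLoad (G L Nc Nu : ℕ) (M : ℝ) : ℝ :=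
  sInf {R : ℝ | ∃ B : ℕ, 0 < B ∧ ∃ χ : Placement G L Nc Nu B, FitsMemory χ M ∧ R = worstLoad χ}

/-! ### The scheme that separates common and unique files -/

/-- The bits of the file `f` that are cached by the users in `T` and by no other user. -/
def subfile {G L Nc Nu B : ℕ} (χ : Placement G L Nc Nu B) (f : FileId G Nc Nu)
    (T : Finset (User G L)) : Finset (Fin B) :=
  Finset.univ.filter fun b => ∀ k, (f, b) ∈ χ k ↔ k ∈ T

/-- The placement of the scheme: the common files are placed over all `G * L` users by the
Maddah-Ali–Niesen placement with parameter `tc` (each file is cut into `(G * L).choose tc` subfiles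
of equal size, one for each set `T` of `tc` users, and cached by exactly the users in `T`), and the
unique files of each group are placed over the `L` users of that group in the same way, with
parameter `tu`. -/
def IsSeparatePlacement {G L Nc Nu B : ℕ} (χ : Placement G L Nc Nu B) (tc tu : ℕ) : Prop :=
  (∀ (n : Fin Nc) (T : Finset (User G L)),
    (subfile χ (Sum.inl n) T).card * (G * L).choose tc = if T.card = tc then B else 0) ∧
  (∀ (g : Fin G) (n : Fin Nu) (T : Finset (User G L)),
    (subfile χ (Sum.inr (g, n)) T).card * L.choose tu =
      if T.card = tu ∧ ∀ k ∈ T, k.1 = g then B else 0)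

/-- The binomial coefficient of real numbers, through the Gamma function, with the convention that
it vanishes for `n < 0`, for `k < 0`, and for `n + 1 ≤ k` (for integers this says `n < k`). -/
noncomputable def gchoose (n k : ℝ) : ℝ :=
  if 0 ≤ n ∧ 0 ≤ k ∧ k < n + 1 then
    Real.Gamma (n + 1) / (Real.Gamma (k + 1) * Real.Gamma (n - k + 1))
  else 0

/-- `t_c = K β M / N_c`. -/
noncomputable def tCommon (G L Nc : ℕ) (M β : ℝ) : ℝ := (G * L : ℝ) * β * M / Nc

/-- `t_u = K (1 - β) M / (G N_u)`. -/
noncomputable def tUnique (G L Nu : ℕ) (M β : ℝ) : ℝ := (G * L : ℝ) * (1 - β) * M / (G * Nu)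

/-- `R(β, α)`: the load of the scheme when the fraction `β` of the memory is given to the common
files, and `α` users per group request unique files. -/
noncomputable def schemeLoad (G L Nc Nu : ℕ) (M β α : ℝ) : ℝ :=
  (gchoose (G * L) (tCommon G L Nc M β + 1) - gchoose (G * α) (tCommon G L Nc M β + 1)) /
      gchoose (G * L) (tCommon G L Nc M β)
    + G * ((gchoose L (tUnique G L Nu M β + 1) - gchoose (L - α) (tUnique G L Nu M β + 1)) /
      gchoose L (tUnique G L Nu M β))

/-- `max_α R(β, α)`, with `α` in `[0, K / G]`. -/
noncomputable def schemeWorst (G L Nc Nu : ℕ) (M β : ℝ) : ℝ :=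
  ⨆ α : Set.Icc (0 : ℝ) L, schemeLoad G L Nc Nu M β α

/-- `min_β max_α R(β, α)`. -/
noncomputable def achievableLoad (G L Nc Nu : ℕ) (M : ℝ) : ℝ :=
  ⨅ β : Set.Icc (0 : ℝ) 1, schemeWorst G L Nc Nu M β

end CodedCaching

/-!
The scheme that separates common and unique files is within a factor two of the optimum under
uncoded placement.
-/

namespace CodedCaching

open Finset

set_option synthInstance.maxSize 1024

variable {G L Nc Nu B : ℕ}

/-! ### Real binomial coefficients -/

/-! Factor two. For an uncoded placement, let `β` be the share of the total cache budget spent on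
common bits. The memory constraint then bounds the average number of users holding a common bit by
`t_c`, and a unique bit by `t_u` (`exists_memory_share`). Demands for common files alone force load
`(K - t_c)/(t_c + 1)`, and demands for unique files alone force `G (L - t_u)/(t_u + 1)`, so each is
at most the worst load. Dropping the subtracted binomials from `R(β, α)` leaves at most the sum of
these two quantities when both are nonnegative, so twice the worst load bounds `R(β, α)` for every
`α`.

Both lower bounds come from random orders of the users. In any order, the requested bits cached
neither by their requester nor by anyone earlier can be recovered from the message alone
(`card_freshBits_le`). A bit with `s` holders, none of them its requester, is counted with
probability `1/(s + 1)`. Averaging over cyclic shifts of a demand makes every file count equally,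
and convexity of `s ↦ (a - s)/(s + 1)` brings in the average number of holders.

Achievability. Each class of files (common, or unique to one group) is delivered by coded multicast
to those user sets that contain a requester of that class. The load depends on how many users in
each group want common files; Jensen's inequality for binomials shows that an even spread is worst,
which gives `R(β, α)` with `α` the average number of unique requests per group. -/

theorem gchoose_nonneg (n k : ℝ) : 0 ≤ gchoose n k := by
  unfold gchoose
  split_ifs with h
  · obtain ⟨hn, hk, hkn⟩ := h
    exact div_nonneg (Real.Gamma_pos_of_pos (by linarith)).le
      (mul_nonneg (Real.Gamma_pos_of_pos (by linarith)).le
        (Real.Gamma_pos_of_pos (by linarith)).le)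
  · exact le_rfl

theorem gchoose_eq_zero {n k : ℝ} (h : n + 1 ≤ k) : gchoose n k = 0 :=
  if_neg fun h' => absurd h'.2.2 (not_lt.2 h)

theorem gchoose_natCast (n k : ℕ) : gchoose n k = (n.choose k : ℝ) := by
  rcases le_or_gt k n with h | h
  · have hlt : (k : ℝ) < n + 1 := by exact_mod_cast Nat.lt_succ_of_le h
    rw [gchoose, if_pos ⟨n.cast_nonneg, k.cast_nonneg, hlt⟩, ← Nat.cast_sub h,
      Real.Gamma_nat_eq_factorial, Real.Gamma_nat_eq_factorial, Real.Gamma_nat_eq_factorial,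
      Nat.cast_choose ℝ h]
  · rw [gchoose_eq_zero (by exact_mod_cast h), Nat.choose_eq_zero_of_lt h, Nat.cast_zero]

theorem gchoose_add_one_div {n t : ℝ} (ht : 0 ≤ t) (htn : t < n) :
    gchoose n (t + 1) / gchoose n t = (n - t) / (t + 1) := by
  have h1 : gchoose n (t + 1) =
      Real.Gamma (n + 1) / (Real.Gamma (t + 1 + 1) * Real.Gamma (n - (t + 1) + 1)) :=
    if_pos ⟨by linarith, by linarith, by linarith⟩
  have h2 : gchoose n t = Real.Gamma (n + 1) / (Real.Gamma (t + 1) * Real.Gamma (n - t + 1)) :=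
    if_pos ⟨by linarith, by linarith, by linarith⟩
  rw [h1, h2, Real.Gamma_add_one (s := t + 1) (by linarith),
    Real.Gamma_add_one (s := n - t) (by linarith), show n - (t + 1) + 1 = n - t by ring]
  have e1 := (Real.Gamma_pos_of_pos (show 0 < n + 1 by linarith)).ne'
  have e2 := (Real.Gamma_pos_of_pos (show 0 < t + 1 by linarith)).ne'
  have e3 := (Real.Gamma_pos_of_pos (show 0 < n - t by linarith)).ne'
  have e4 : t + 1 ≠ 0 := by linarith
  have e5 : n - t ≠ 0 := by linarith
  field_simp

/-- For `t ≥ n` the numerator vanishes by convention while `(n - t) / (t + 1)` may be negative; this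
is why `0 ≤ x` is needed. -/
theorem gchoose_add_one_div_le {n t x : ℝ} (ht : 0 ≤ t) (hx : 0 ≤ x)
    (h : (n - t) / (t + 1) ≤ x) : gchoose n (t + 1) / gchoose n t ≤ x := by
  rcases lt_or_ge t n with htn | htn
  · rwa [gchoose_add_one_div ht htn]
  · rwa [gchoose_eq_zero (by linarith), zero_div]

theorem Gamma_add_one_eq_descPochhammer (m : ℕ) {x : ℝ} (hx : (m : ℝ) - 1 < x) :
    Real.Gamma (x + 1) = (descPochhammer ℝ m).eval x * Real.Gamma (x - m + 1) := by
  induction m with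
  | zero => simp
  | succ m ih =>
    push_cast at hx ⊢
    rw [ih (by linarith), descPochhammer_succ_eval, Real.Gamma_add_one (s := x - m) (by linarith),
      show x - (m + 1) + 1 = x - m by ring]
    ring

theorem gchoose_eq_descPochhammer {m : ℕ} {x : ℝ} (hx0 : 0 ≤ x) (hx : (m : ℝ) - 1 < x) :
    gchoose x m = (descPochhammer ℝ m).eval x / m.factorial := by
  have e := (Real.Gamma_pos_of_pos (show 0 < x - m + 1 by linarith)).ne'
  rw [gchoose, if_pos ⟨hx0, m.cast_nonneg, by linarith⟩, Gamma_add_one_eq_descPochhammer m hx,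
    Real.Gamma_nat_eq_factorial, mul_div_mul_right _ _ e]

/-- Jensen's inequality for binomial coefficients. -/
theorem card_mul_gchoose_average_le {ι : Type*} (s : Finset ι) (hs : s.Nonempty) (p : ι → ℕ)
    {m : ℕ} (hm : m ≠ 0) {x : ℝ} (hx : (s.card : ℝ) * x = ∑ i ∈ s, (p i : ℝ)) :
    s.card * gchoose x m ≤ ∑ i ∈ s, ((p i).choose m : ℝ) := by
  have hc : (0 : ℝ) < s.card := by exact_mod_cast hs.card_pos
  rcases le_or_gt (x + 1) m with h | h
  -- Below `m - 1` the truncated binomial is zero, and Jensen's inequality for the falling factorial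
  -- is needed only above that point.
  · rw [gchoose_eq_zero h, mul_zero]
    exact Finset.sum_nonneg fun _ _ => Nat.cast_nonneg _
  · have hx' : ∑ i ∈ s, (1 / s.card : ℝ) * (p i : ℝ) = x := by
      rw [← Finset.mul_sum, ← hx]; field_simp
    have hx0 : 0 ≤ x := by
      rw [← hx']; positivity
    have key := descPochhammer_eval_div_factorial_le_sum_choose hm (t := s) p (fun _ => (1 / s.card : ℝ))
      (fun _ _ => by positivity) (by simp [hc.ne']) (by rw [hx']; linarith)
    rw [hx', ← gchoose_eq_descPochhammer hx0 (by linarith), ← Finset.mul_sum] at key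
    calc s.card * gchoose x m ≤ s.card * (1 / s.card * ∑ i ∈ s, ((p i).choose m : ℝ)) := by gcongr
      _ = _ := by field_simp

/-! ### The length of a message -/

/-- It suffices that message and cache determine the requested file: the decoder picks any library
consistent with both and reads the file there. -/
theorem canServe_of_injOn {χ : Placement G L Nc Nu B} {d : Demand G L Nc Nu}
    {I : Type*} [Fintype I] (enc : Library G Nc Nu B → I → Bool)
    (h : ∀ (k : User G L) (W W' : Library G Nc Nu B), enc W = enc W' →
      (∀ p ∈ χ k, W p = W' p) → ∀ b, W (requested d k, b) = W' (requested d k, b)) :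
    CanServe χ d (Fintype.card I) := by
  classical
  let e := Fintype.equivFin I
  let dec : ∀ k : User G L, (Fin (Fintype.card I) → Bool) → ({p // p ∈ χ k} → Bool) →
      (Fin B → Bool) := fun k m c =>
    if hW : ∃ W : Library G Nc Nu B, (fun i => enc W (e.symm i)) = m ∧ (fun p => W p.1) = c then
      fun b => hW.choose (requested d k, b) else fun _ => false
  refine ⟨fun W i => enc W (e.symm i), dec, fun W k => ?_⟩
  have hW : ∃ W' : Library G Nc Nu B, (fun i => enc W' (e.symm i)) = (fun i => enc W (e.symm i)) ∧
      (fun p : {p // p ∈ χ k} => W' p.1) = fun p => W p.1 := ⟨W, rfl, rfl⟩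
  have hdec : dec k (fun i => enc W (e.symm i)) (fun p => W p.1) =
      fun b => hW.choose (requested d k, b) := dif_pos hW
  rw [hdec]
  funext b
  refine h k _ _ ?_ (fun p hp => congrFun hW.choose_spec.2 ⟨p, hp⟩) b
  funext i
  simpa using congrFun hW.choose_spec.1 (e i)

/-- Nonemptiness matters because `sInf ∅ = 0` in `ℕ`; it makes the minimal length in `load`
attained. -/
theorem exists_canServe (χ : Placement G L Nc Nu B) (d : Demand G L Nc Nu) :
    {ℓ : ℕ | CanServe χ d ℓ}.Nonempty :=
  ⟨_, canServe_of_injOn (χ := χ) (d := d) (fun W => W) fun _ _ _ h _ _ => congrFun h _⟩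

theorem load_nonneg (χ : Placement G L Nc Nu B) (d : Demand G L Nc Nu) : 0 ≤ load χ d := by
  unfold load; positivity

theorem load_le_worstLoad (χ : Placement G L Nc Nu B) (d : DistinctDemand G L Nc Nu) :
    load χ d.1 ≤ worstLoad χ :=
  le_ciSup (f := fun d : DistinctDemand G L Nc Nu => load χ d.1) (Set.finite_range _).bddAbove d

theorem worstLoad_nonneg (χ : Placement G L Nc Nu B) : 0 ≤ worstLoad χ :=
  Real.iSup_nonneg fun d => load_nonneg χ d.1

theorem optimalLoad_le_worstLoad (hB : 0 < B) (χ : Placement G L Nc Nu B) {M : ℝ}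
    (h : FitsMemory χ M) : optimalLoad G L Nc Nu M ≤ worstLoad χ := by
  refine csInf_le ⟨0, ?_⟩ ⟨B, hB, χ, h, rfl⟩
  rintro R ⟨B, -, χ, -, rfl⟩
  exact worstLoad_nonneg χ

/-! ### The converse bound for uncoded placement -/

/-- The users that cache the position `p`. -/
def holders (χ : Placement G L Nc Nu B) (p : BitPos G Nc Nu B) : Finset (User G L) :=
  univ.filter fun k => p ∈ χ k

theorem mem_holders {χ : Placement G L Nc Nu B} {p : BitPos G Nc Nu B} {k : User G L} :
    k ∈ holders χ p ↔ p ∈ χ k := by simp [holders]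

/-- The requested bits that neither the user who wants them nor any earlier user has cached. -/
def freshBits {n : ℕ} (χ : Placement G L Nc Nu B) (d : Demand G L Nc Nu) (σ : User G L ≃ Fin n) :
    Finset (BitPos G Nc Nu B) :=
  univ.filter fun p => ∃ k, p.1 = requested d k ∧ ∀ j, σ j ≤ σ k → p ∉ χ j

/-- Set all other bits to `false` and decode along `σ`. A fresh bit in the cache of a user was
requested by an earlier user, so it is already known. Hence the message determines the fresh bits,
and `2 ^ card ≤ 2 ^ ℓ`. -/
theorem card_freshBits_le {n ℓ : ℕ} {χ : Placement G L Nc Nu B} {d : Demand G L Nc Nu}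
    (σ : User G L ≃ Fin n) (h : CanServe χ d ℓ) : (freshBits χ d σ).card ≤ ℓ := by
  classical
  obtain ⟨enc, dec, hdec⟩ := h
  let A := freshBits χ d σ
  let ext : (A → Bool) → Library G Nc Nu B := fun w p => if hp : p ∈ A then w ⟨p, hp⟩ else false
  have hinj : Function.Injective fun w => enc (ext w) := by
    intro w w' hw
    have hagree : ∀ (m : ℕ) (k : User G L), (σ k : ℕ) = m →
        ∀ b, ext w (requested d k, b) = ext w' (requested d k, b) := by
      intro m
      induction m using Nat.strong_induction_on with
      | _ m ih =>
        intro k hk b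
        have hcache : (fun p : {p // p ∈ χ k} => ext w p.1) = fun p => ext w' p.1 := by
          funext ⟨p, hp⟩
          by_cases hpA : p ∈ A
          · obtain ⟨j, hj, hj'⟩ := (mem_filter.1 hpA).2
            have hlt : σ j < σ k := by
              by_contra hle
              exact hj' k (not_lt.1 hle) hp
            have := ih (σ j) (by rw [← hk]; exact hlt) j rfl p.2
            rwa [← hj] at this
          · simp [ext, hpA]
        have h1 := hdec (ext w) k
        have h2 := hdec (ext w') k
        rw [hcache, show enc (ext w) = enc (ext w') from hw, h2] at h1
        exact (congrFun h1 b).symm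
    funext ⟨p, hp⟩
    obtain ⟨k, hk, -⟩ := (mem_filter.1 hp).2
    have := hagree _ k rfl p.2
    rw [← hk] at this
    simpa [ext, hp] using this
  have := Fintype.card_le_of_injective _ hinj
  simp only [Fintype.card_fun, Fintype.card_bool, Fintype.card_coe, Fintype.card_fin] at this
  exact (Nat.pow_le_pow_iff_right (by norm_num)).1 this

/-- Each element of `S` comes first in `S` in the same number of orders. -/
theorem card_first_mul_card {U : Type*} [Fintype U] [DecidableEq U] {n : ℕ} (S : Finset U) {k : U}
    (hk : k ∈ S) :
    (univ.filter fun σ : U ≃ Fin n => ∀ j ∈ S, σ k ≤ σ j).card * S.card =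
      Fintype.card (U ≃ Fin n) := by
  have hsame : ∀ k' ∈ S, (univ.filter fun σ : U ≃ Fin n => ∀ j ∈ S, σ k' ≤ σ j).card =
      (univ.filter fun σ : U ≃ Fin n => ∀ j ∈ S, σ k ≤ σ j).card := by
    intro k' hk'
    have hswap : ∀ {a c : U}, a ∈ S → c ∈ S → ∀ j ∈ S, Equiv.swap a c j ∈ S := by
      intro a c ha hc j hj
      rw [Equiv.swap_apply_def]
      split_ifs <;> assumption
    -- Relabelling by a transposition exchanges the orders led by `k'` with those led by `k`.
    refine card_bij' (fun σ _ => (Equiv.swap k k').trans σ) (fun σ _ => (Equiv.swap k k').trans σ)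
      ?_ ?_ ?_ ?_
    · intro σ hσ
      rw [mem_filter] at hσ ⊢
      refine ⟨mem_univ _, fun j hj => ?_⟩
      simpa using hσ.2 _ (hswap hk hk' j hj)
    · intro σ hσ
      rw [mem_filter] at hσ ⊢
      refine ⟨mem_univ _, fun j hj => ?_⟩
      simpa using hσ.2 _ (hswap hk hk' j hj)
    · intro σ _; ext; simp
    · intro σ _; ext; simp
  have hone : ∀ σ : U ≃ Fin n, (S.filter fun k' => ∀ j ∈ S, σ k' ≤ σ j).card = 1 := by
    intro σ
    obtain ⟨k₀, hk₀, hmin⟩ := S.exists_min_image σ ⟨k, hk⟩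
    rw [card_eq_one]
    refine ⟨k₀, ?_⟩
    ext x
    simp only [mem_filter, mem_singleton]
    constructor
    · rintro ⟨hx, hx'⟩
      exact σ.injective (le_antisymm (hx' _ hk₀) (hmin _ hx))
    · rintro rfl
      exact ⟨hk₀, hmin⟩
  calc _ = ∑ k' ∈ S, (univ.filter fun σ : U ≃ Fin n => ∀ j ∈ S, σ k' ≤ σ j).card := by
        rw [sum_congr rfl hsame, sum_const, smul_eq_mul, mul_comm]
    _ = ∑ σ : U ≃ Fin n, (S.filter fun k' => ∀ j ∈ S, σ k' ≤ σ j).card := by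
        simp_rw [card_filter]
        exact sum_comm
    _ = _ := by simp [hone]

/-- The probability that, in a random order, user `k` precedes every user that caches `p`. -/
noncomputable def freshWeight (χ : Placement G L Nc Nu B) (k : User G L)
    (p : BitPos G Nc Nu B) : ℝ :=
  if k ∈ holders χ p then 0 else 1 / ((holders χ p).card + 1)

/-- A user who does not hold `p` is fresh for it exactly when coming first in the set formed by this
user and the holders. -/
theorem sum_fresh_indicator {n : ℕ} (χ : Placement G L Nc Nu B) (k : User G L)
    (p : BitPos G Nc Nu B) :
    ((univ.filter fun σ : User G L ≃ Fin n => ∀ j, σ j ≤ σ k → p ∉ χ j).card : ℝ) =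
      Fintype.card (User G L ≃ Fin n) * freshWeight χ k p := by
  unfold freshWeight
  split_ifs with hk
  · rw [mem_holders] at hk
    rw [mul_zero, Nat.cast_eq_zero, card_eq_zero, filter_eq_empty_iff]
    exact fun σ _ h => h k le_rfl hk
  · have key := card_first_mul_card (n := n) (insert k (holders χ p)) (mem_insert_self _ _)
    rw [card_insert_of_notMem hk] at key
    have hset : (univ.filter fun σ : User G L ≃ Fin n => ∀ j, σ j ≤ σ k → p ∉ χ j) =
        univ.filter fun σ : User G L ≃ Fin n => ∀ j ∈ insert k (holders χ p), σ k ≤ σ j := by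
      ext σ
      simp only [mem_filter, mem_univ, true_and, mem_insert, forall_eq_or_imp, le_refl,
        mem_holders]
      constructor
      · exact fun h j hj => le_of_not_ge fun hle => h j hle hj
      · intro h j hj hp
        have : j = k := σ.injective (le_antisymm hj (h j hp))
        exact hk (mem_holders.2 (this ▸ hp))
    rw [hset, ← key]
    push_cast
    field_simp

theorem sum_freshWeight_le_load (hB : 0 < B) (χ : Placement G L Nc Nu B)
    (d : DistinctDemand G L Nc Nu) :
    ∑ k, ∑ b, freshWeight χ k (requested d.1 k, b) ≤ load χ d.1 * B := by
  classical
  let n := Fintype.card (User G L)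
  set ℓ := sInf {ℓ : ℕ | CanServe χ d.1 ℓ} with hℓ
  have hserve : CanServe χ d.1 ℓ := Nat.sInf_mem (exists_canServe χ d.1)
  have hload : load χ d.1 * B = ℓ := by
    have : (B : ℝ) ≠ 0 := by positivity
    rw [load, ← hℓ]; field_simp
  rw [hload]
  have hP : 0 < (Fintype.card (User G L ≃ Fin n) : ℝ) := by
    have : Nonempty (User G L ≃ Fin n) := ⟨Fintype.equivFin _⟩
    exact_mod_cast Fintype.card_pos
  have hcard : ∀ σ : User G L ≃ Fin n, ∑ k, ∑ b : Fin B,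
      (if ∀ j, σ j ≤ σ k → (requested d.1 k, b) ∉ χ j then (1 : ℝ) else 0) ≤ ℓ := by
    intro σ
    refine le_trans ?_ (Nat.cast_le.2 (card_freshBits_le σ hserve))
    rw [← Fintype.sum_prod_type', sum_boole, Nat.cast_le]
    -- Distinctness of the requests enters here: no bit is counted for two users.
    refine card_le_card_of_injOn (fun x => (requested d.1 x.1, x.2)) ?_ ?_
    · rintro ⟨k, b⟩ hx
      simp only [coe_filter, mem_univ, true_and, Set.mem_ofPred_eq] at hx
      simp only [freshBits, coe_filter, mem_univ, true_and, Set.mem_ofPred_eq]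
      exact ⟨k, rfl, hx⟩
    · rintro ⟨k, b⟩ - ⟨k', b'⟩ - h
      simp only [Prod.mk.injEq] at h ⊢
      exact ⟨d.2 h.1, h.2⟩
  have hsum := sum_le_sum fun (σ : User G L ≃ Fin n) (_ : σ ∈ univ) => hcard σ
  rw [sum_const, nsmul_eq_mul, card_univ, sum_comm] at hsum
  have hswap : ∀ k, ∑ σ : User G L ≃ Fin n, ∑ b : Fin B,
      (if ∀ j, σ j ≤ σ k → (requested d.1 k, b) ∉ χ j then (1 : ℝ) else 0) =
      Fintype.card (User G L ≃ Fin n) * ∑ b, freshWeight χ k (requested d.1 k, b) := by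
    intro k
    rw [sum_comm, mul_sum]
    refine sum_congr rfl fun b _ => ?_
    rw [sum_boole, sum_fresh_indicator]
  simp_rw [hswap] at hsum
  rw [← mul_sum] at hsum
  exact le_of_mul_le_mul_left hsum hP

/-- Tangent line bound: by convexity of `s ↦ (a - s) / (s + 1)`, the average of its values is at
least its value at any upper bound for the average of `s`. -/
theorem card_mul_le_sum_div {ι : Type*} (P : Finset ι) (s : ι → ℝ) (hs : ∀ i ∈ P, 0 ≤ s i)
    {a t : ℝ} (ha : 0 ≤ a) (ht : 0 ≤ t) (hst : ∑ i ∈ P, s i ≤ P.card * t) :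
    P.card * ((a - t) / (t + 1)) ≤ ∑ i ∈ P, (a - s i) / (s i + 1) := by
  have hpt : ∀ i ∈ P,
      (a - t) / (t + 1) - (a + 1) / (t + 1) ^ 2 * (s i - t) ≤ (a - s i) / (s i + 1) := by
    intro i hi
    have h1 : 0 < s i + 1 := by linarith [hs i hi]
    have h2 : 0 < t + 1 := by linarith
    have : (a - s i) / (s i + 1) - ((a - t) / (t + 1) - (a + 1) / (t + 1) ^ 2 * (s i - t)) =
        (a + 1) * (s i - t) ^ 2 / ((s i + 1) * (t + 1) ^ 2) := by
      field_simp
      ring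
    have h3 : 0 ≤ (a + 1) * (s i - t) ^ 2 / ((s i + 1) * (t + 1) ^ 2) := by positivity
    linarith
  have hsum := sum_le_sum hpt
  rw [sum_sub_distrib, sum_const, nsmul_eq_mul, ← mul_sum, sum_sub_distrib, sum_const,
    nsmul_eq_mul] at hsum
  have : 0 ≤ (a + 1) / (t + 1) ^ 2 := by positivity
  nlinarith

/-- Each non-holder in `U` contributes `1 / (s + 1)`. There are at least `card U - s` of them,
possibly more, since holders outside `U` do not help `U`. -/
theorem sum_freshWeight (χ : Placement G L Nc Nu B) (p : BitPos G Nc Nu B)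
    (U : Finset (User G L)) :
    ((U.card : ℝ) - (holders χ p).card) / ((holders χ p).card + 1) ≤
      ∑ k ∈ U, freshWeight χ k p := by
  have h : ∑ k ∈ U, freshWeight χ k p =
      (U.filter fun k => k ∉ holders χ p).card * (1 / ((holders χ p).card + 1) : ℝ) := by
    rw [← sum_filter_add_sum_filter_not U (fun k => k ∈ holders χ p), sum_eq_zero, zero_add,
      sum_congr rfl (g := fun _ => (1 / ((holders χ p).card + 1) : ℝ)), sum_const, nsmul_eq_mul]
    · intro k hk; exact if_neg (mem_filter.1 hk).2
    · intro k hk; exact if_pos (mem_filter.1 hk).2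
  have hc : (U.card : ℝ) ≤ (U.filter fun k => k ∉ holders χ p).card + (holders χ p).card := by
    rw [filter_notMem_eq_sdiff]
    exact_mod_cast card_le_card_sdiff_add_card
  rw [h, mul_one_div]
  gcongr
  linarith

theorem le_worstLoad_of_demands {ι : Type*} [Fintype ι] (hι : 0 < Fintype.card ι)
    (hB : 0 < B) (χ : Placement G L Nc Nu B) (d : ι → DistinctDemand G L Nc Nu) {X : ℝ}
    (hX : Fintype.card ι * (X * B) ≤ ∑ k, ∑ i, ∑ b, freshWeight χ k (requested (d i).1 k, b)) :
    X ≤ worstLoad χ := by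
  rw [sum_comm] at hX
  have h : ∑ i, ∑ k, ∑ b, freshWeight χ k (requested (d i).1 k, b) ≤
      ∑ _i : ι, worstLoad χ * B := by
    refine sum_le_sum fun i _ => (sum_freshWeight_le_load hB χ (d i)).trans ?_
    gcongr
    exact load_le_worstLoad χ (d i)
  rw [sum_const, nsmul_eq_mul, card_univ] at h
  have hB' : (0 : ℝ) < B := by exact_mod_cast hB
  have hι' : (0 : ℝ) < Fintype.card ι := by exact_mod_cast hι
  exact le_of_mul_le_mul_right (le_of_mul_le_mul_left (hX.trans h) hι') hB'

/-- If the bits of the common files are cached by at most `t` users on average, then the demands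
for common files alone require the load `(K - t) / (t + 1)`. -/
theorem common_le_worstLoad (hG : 0 < G) (hL : 0 < L) (hNc : G * L ≤ Nc) (hB : 0 < B)
    (χ : Placement G L Nc Nu B) {t : ℝ} (ht : 0 ≤ t)
    (h : ∑ x : Fin Nc × Fin B, ((holders χ (Sum.inl x.1, x.2)).card : ℝ) ≤ Nc * B * t) :
    ((G * L : ℝ) - t) / (t + 1) ≤ worstLoad χ := by
  classical
  have hNc0 : 0 < Nc := lt_of_lt_of_le (Nat.mul_pos hG hL) hNc
  have : NeZero Nc := ⟨hNc0.ne'⟩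
  let idx : User G L → Fin Nc := fun k => Fin.castLE hNc (finProdFinEquiv k)
  have hidx : Function.Injective idx :=
    (Fin.castLE_injective hNc).comp finProdFinEquiv.injective
  -- Cyclic shifts of one injective assignment: as `i` varies, every user requests every common file
  -- exactly once.
  let d : Fin Nc → DistinctDemand G L Nc Nu := fun i =>
    ⟨fun k => Sum.inl (idx k + i), fun k k' hk => hidx (by simpa [requested] using hk)⟩
  refine le_worstLoad_of_demands (by simpa using hNc0) hB χ d ?_
  have hsum : ∀ k, ∑ i, ∑ b, freshWeight χ k (requested (d i).1 k, b) =
      ∑ x : Fin Nc × Fin B, freshWeight χ k (Sum.inl x.1, x.2) := by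
    intro k
    rw [Fintype.sum_prod_type]
    exact Fintype.sum_equiv (Equiv.addLeft (idx k)) _ _ fun i => by simp [d, requested]
  simp_rw [hsum]
  rw [sum_comm]
  refine le_trans ?_ (sum_le_sum fun x _ => sum_freshWeight χ (Sum.inl x.1, x.2) univ)
  have key := card_mul_le_sum_div (univ : Finset (Fin Nc × Fin B))
    (fun x => ((holders χ (Sum.inl x.1, x.2)).card : ℝ)) (fun _ _ => Nat.cast_nonneg _)
    (a := (G * L : ℝ)) (by positivity) ht (by simpa using h)
  refine le_trans (le_of_eq ?_) (key.trans (le_of_eq ?_))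
  · simp; ring
  · simp

/-- If the bits of the unique files are cached by at most `t` users on average, then the demands
for unique files alone require the load `G (L - t) / (t + 1)`. -/
theorem unique_le_worstLoad (hL : 0 < L) (hNu : L ≤ Nu) (hB : 0 < B)
    (χ : Placement G L Nc Nu B) {t : ℝ} (ht : 0 ≤ t)
    (h : ∑ x : (Fin G × Fin Nu) × Fin B, ((holders χ (Sum.inr x.1, x.2)).card : ℝ) ≤
      G * Nu * B * t) :
    G * (((L : ℝ) - t) / (t + 1)) ≤ worstLoad χ := by
  classical
  have hNu0 : 0 < Nu := lt_of_lt_of_le hL hNu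
  have : NeZero Nu := ⟨hNu0.ne'⟩
  let d : Fin Nu → DistinctDemand G L Nc Nu := fun i =>
    ⟨fun k => Sum.inr (Fin.castLE hNu k.2 + i), fun k k' hk => by
      simp only [requested, Sum.map_inr, Sum.inr.injEq, Prod.mk.injEq, add_left_inj] at hk
      exact Prod.ext hk.1 (Fin.castLE_injective hNu hk.2)⟩
  refine le_worstLoad_of_demands (by simpa using hNu0) hB χ d ?_
  have hsum : ∀ k, ∑ i, ∑ b, freshWeight χ k (requested (d i).1 k, b) =
      ∑ x : Fin Nu × Fin B, freshWeight χ k (Sum.inr (k.1, x.1), x.2) := by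
    intro k
    rw [Fintype.sum_prod_type]
    exact Fintype.sum_equiv (Equiv.addLeft (Fin.castLE hNu k.2)) _ _ fun i => by
      simp [d, requested]
  -- Regrouped by bit: a unique file is requested only by the `L` users of its own group.
  have hgroup : ∑ k : User G L, ∑ x : Fin Nu × Fin B, freshWeight χ k (Sum.inr (k.1, x.1), x.2) =
      ∑ x : (Fin G × Fin Nu) × Fin B,
        ∑ k ∈ univ.image (fun l : Fin L => (x.1.1, l)), freshWeight χ k (Sum.inr x.1, x.2) := by
    simp_rw [sum_image fun (a : Fin L) _ (b : Fin L) _ h => (Prod.mk.inj h).2]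
    simp_rw [Fintype.sum_prod_type]
    refine sum_congr rfl fun g _ => ?_
    rw [sum_comm]
    refine sum_congr rfl fun n _ => sum_comm
  simp_rw [hsum]
  rw [hgroup]
  refine le_trans ?_ (sum_le_sum fun x _ => sum_freshWeight χ (Sum.inr x.1, x.2) _)
  have key := card_mul_le_sum_div (univ : Finset ((Fin G × Fin Nu) × Fin B))
    (fun x => ((holders χ (Sum.inr x.1, x.2)).card : ℝ)) (fun _ _ => Nat.cast_nonneg _)
    (a := (L : ℝ)) (by positivity) ht (by simpa using h)
  refine le_trans (le_of_eq ?_) (key.trans (le_of_eq ?_))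
  · simp; ring
  · refine sum_congr rfl fun x _ => ?_
    rw [card_image_of_injective _ (Prod.mk_right_injective _)]
    simp

theorem sum_card_holders (χ : Placement G L Nc Nu B) :
    ∑ p, (holders χ p).card = ∑ k, (χ k).card := by
  simp_rw [holders, card_filter]
  rw [sum_comm]
  simp

/-! ### The load formula -/

theorem tCommon_nonneg {M β : ℝ} (hM : 0 ≤ M) (hβ : 0 ≤ β) : 0 ≤ tCommon G L Nc M β := by
  unfold tCommon; positivity

theorem tUnique_nonneg {M β : ℝ} (hM : 0 ≤ M) (hβ : β ≤ 1) : 0 ≤ tUnique G L Nu M β := by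
  have : 0 ≤ 1 - β := by linarith
  unfold tUnique; positivity

theorem schemeLoad_le {M β : ℝ} (hG : 0 < G) (hM : 0 ≤ M) (hβ0 : 0 ≤ β) (hβ1 : β ≤ 1) {X Y : ℝ}
    (hX0 : 0 ≤ X) (hY0 : 0 ≤ Y)
    (hX : ((G * L : ℝ) - tCommon G L Nc M β) / (tCommon G L Nc M β + 1) ≤ X)
    (hY : G * (((L : ℝ) - tUnique G L Nu M β) / (tUnique G L Nu M β + 1)) ≤ Y) (α : ℝ) :
    schemeLoad G L Nc Nu M β α ≤ X + Y := by
  have hG' : (0 : ℝ) < G := by exact_mod_cast hG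
  have drop : ∀ a b c : ℝ, 0 ≤ b → 0 ≤ c → (a - b) / c ≤ a / c := fun a b c hb hc =>
    div_le_div_of_nonneg_right (by linarith) hc
  unfold schemeLoad
  refine add_le_add ((drop _ _ _ (gchoose_nonneg _ _) (gchoose_nonneg _ _)).trans
    (gchoose_add_one_div_le (tCommon_nonneg hM hβ0) hX0 hX)) ?_
  rw [← le_div_iff₀' hG'] at hY ⊢
  exact (drop _ _ _ (gchoose_nonneg _ _) (gchoose_nonneg _ _)).trans
    (gchoose_add_one_div_le (tUnique_nonneg hM hβ1) (by positivity) hY)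

theorem schemeWorst_le {M β : ℝ} (hG : 0 < G) (hM : 0 ≤ M) (hβ0 : 0 ≤ β) (hβ1 : β ≤ 1) {X Y : ℝ}
    (hX0 : 0 ≤ X) (hY0 : 0 ≤ Y)
    (hX : ((G * L : ℝ) - tCommon G L Nc M β) / (tCommon G L Nc M β + 1) ≤ X)
    (hY : G * (((L : ℝ) - tUnique G L Nu M β) / (tUnique G L Nu M β + 1)) ≤ Y) :
    schemeWorst G L Nc Nu M β ≤ X + Y :=
  have : Nonempty (Set.Icc (0 : ℝ) L) := ⟨⟨0, le_rfl, L.cast_nonneg⟩⟩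
  ciSup_le fun α => schemeLoad_le hG hM hβ0 hβ1 hX0 hY0 hX hY α

/-- A real supremum is informative only when bounded above; `schemeLoad_le` supplies a bound uniform
in `α`. -/
theorem schemeLoad_le_schemeWorst {M β α : ℝ} (hG : 0 < G) (hM : 0 ≤ M) (hβ0 : 0 ≤ β)
    (hβ1 : β ≤ 1) (hα : α ∈ Set.Icc (0 : ℝ) L) :
    schemeLoad G L Nc Nu M β α ≤ schemeWorst G L Nc Nu M β := by
  refine le_ciSup (f := fun α : Set.Icc (0 : ℝ) L => schemeLoad G L Nc Nu M β α) ?_ ⟨α, hα⟩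
  refine ⟨max 0 (((G * L : ℝ) - tCommon G L Nc M β) / (tCommon G L Nc M β + 1)) +
    max 0 (G * (((L : ℝ) - tUnique G L Nu M β) / (tUnique G L Nu M β + 1))), ?_⟩
  rintro _ ⟨α, rfl⟩
  exact schemeLoad_le hG hM hβ0 hβ1 (le_max_left 0 _) (le_max_left 0 _) (le_max_right _ _)
    (le_max_right _ _) α

theorem schemeWorst_nonneg {M β : ℝ} (hG : 0 < G) (hM : 0 ≤ M) (hβ0 : 0 ≤ β) (hβ1 : β ≤ 1) :
    0 ≤ schemeWorst G L Nc Nu M β := by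
  refine le_trans ?_ (schemeLoad_le_schemeWorst hG hM hβ0 hβ1 ⟨le_rfl, L.cast_nonneg⟩)
  have := tCommon_nonneg (G := G) (L := L) (Nc := Nc) hM hβ0
  rw [schemeLoad, mul_zero, sub_zero (L : ℝ), sub_self, zero_div, mul_zero, add_zero,
    gchoose_eq_zero (n := 0) (by linarith), sub_zero]
  exact div_nonneg (gchoose_nonneg _ _) (gchoose_nonneg _ _)

theorem achievableLoad_le_schemeWorst {M β : ℝ} (hG : 0 < G) (hM : 0 ≤ M) (hβ0 : 0 ≤ β)
    (hβ1 : β ≤ 1) : achievableLoad G L Nc Nu M ≤ schemeWorst G L Nc Nu M β := by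
  refine ciInf_le (f := fun β : Set.Icc (0 : ℝ) 1 => schemeWorst G L Nc Nu M β) ⟨0, ?_⟩
    ⟨β, hβ0, hβ1⟩
  rintro _ ⟨β, rfl⟩
  exact schemeWorst_nonneg hG hM β.2.1 β.2.2

/-! ### The factor two -/

/-- The share `β` of the memory that a placement spends on the common files. -/
theorem exists_memory_share (hG : 0 < G) (hL : 0 < L) (hNc : 0 < Nc) (hNu : 0 < Nu) (hB : 0 < B)
    {χ : Placement G L Nc Nu B} {M : ℝ} (hM : 0 ≤ M) (hχ : FitsMemory χ M) :
    ∃ β : ℝ, 0 ≤ β ∧ β ≤ 1 ∧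
      ∑ x : Fin Nc × Fin B, ((holders χ (Sum.inl x.1, x.2)).card : ℝ) ≤
        Nc * B * tCommon G L Nc M β ∧
      ∑ x : (Fin G × Fin Nu) × Fin B, ((holders χ (Sum.inr x.1, x.2)).card : ℝ) ≤
        G * Nu * B * tUnique G L Nu M β := by
  set C := ∑ x : Fin Nc × Fin B, ((holders χ (Sum.inl x.1, x.2)).card : ℝ) with hC
  set U := ∑ x : (Fin G × Fin Nu) × Fin B, ((holders χ (Sum.inr x.1, x.2)).card : ℝ) with hU
  have hC0 : 0 ≤ C := sum_nonneg fun _ _ => Nat.cast_nonneg _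
  have hU0 : 0 ≤ U := sum_nonneg fun _ _ => Nat.cast_nonneg _
  have htot : C + U ≤ G * L * M * B := by
    have h1 : C + U = ∑ k, ((χ k).card : ℝ) := by
      have := sum_card_holders χ
      rw [hC, hU, ← Nat.cast_sum, ← Nat.cast_sum, ← Nat.cast_sum, ← Nat.cast_add, ← this]
      simp_rw [Fintype.sum_prod_type, Fintype.sum_sum_type, Fintype.sum_prod_type]
    rw [h1]
    refine (sum_le_sum fun k _ => hχ k).trans (le_of_eq ?_)
    rw [sum_const, nsmul_eq_mul, card_univ, Fintype.card_prod, Fintype.card_fin, Fintype.card_fin]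
    push_cast
    ring
  have hG' : (0 : ℝ) < G := by exact_mod_cast hG
  have hL' : (0 : ℝ) < L := by exact_mod_cast hL
  have hNc' : (0 : ℝ) < Nc := by exact_mod_cast hNc
  have hNu' : (0 : ℝ) < Nu := by exact_mod_cast hNu
  have hB' : (0 : ℝ) < B := by exact_mod_cast hB
  have ec : ∀ β, Nc * B * tCommon G L Nc M β = β * (G * L * M * B) := by
    intro β; unfold tCommon; field_simp
  have eu : ∀ β, G * Nu * B * tUnique G L Nu M β = (1 - β) * (G * L * M * B) := by
    intro β; unfold tUnique; field_simp
  simp_rw [ec, eu]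
  set T : ℝ := G * L * M * B
  rcases (show (0 : ℝ) ≤ T by positivity).eq_or_lt with h0 | hpos
  -- With no budget both sums vanish, so any `β` would do.
  · exact ⟨0, le_rfl, zero_le_one, by linarith, by linarith⟩
  · refine ⟨C / T, div_nonneg hC0 hpos.le, by rw [div_le_one hpos]; linarith, ?_, ?_⟩
    · rw [div_mul_cancel₀ _ hpos.ne']
    · rw [sub_mul, div_mul_cancel₀ _ hpos.ne']; linarith

theorem achievableLoad_le_two_mul_worstLoad (hG : 0 < G) (hL : 0 < L) (hNc : G * L ≤ Nc)
    (hNu : L ≤ Nu) (hB : 0 < B) {χ : Placement G L Nc Nu B} {M : ℝ} (hM : 0 ≤ M)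
    (hχ : FitsMemory χ M) : achievableLoad G L Nc Nu M ≤ 2 * worstLoad χ := by
  obtain ⟨β, hβ0, hβ1, hc, hu⟩ := exists_memory_share hG hL
    (lt_of_lt_of_le (Nat.mul_pos hG hL) hNc) (lt_of_lt_of_le hL hNu) hB hM hχ
  rw [two_mul]
  exact (achievableLoad_le_schemeWorst hG hM hβ0 hβ1).trans <|
    schemeWorst_le hG hM hβ0 hβ1 (worstLoad_nonneg χ) (worstLoad_nonneg χ)
      (common_le_worstLoad hG hL hNc hB χ (tCommon_nonneg hM hβ0) hc)
      (unique_le_worstLoad hL hNu hB χ (tUnique_nonneg hM hβ1) hu)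

theorem achievableLoad_le_two_mul_optimalLoad (hG : 0 < G) (hL : 0 < L) (hNc : G * L ≤ Nc)
    (hNu : L ≤ Nu) {M : ℝ} (hM : 0 ≤ M) :
    achievableLoad G L Nc Nu M ≤ 2 * optimalLoad G L Nc Nu M := by
  have h : achievableLoad G L Nc Nu M / 2 ≤ optimalLoad G L Nc Nu M := by
    -- Empty caches with one-bit files witness that the set of loads is nonempty.
    refine le_csInf ⟨_, 1, one_pos, fun _ => ∅, fun k => ?_, rfl⟩ ?_
    · rw [card_empty, Nat.cast_zero, Nat.cast_one, mul_one]
      exact hM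
    rintro R ⟨B, hB, χ, hχ, rfl⟩
    linarith [achievableLoad_le_two_mul_worstLoad hG hL hNc hNu hB hM hχ]
  linarith

/-! ### Placement and delivery of the scheme

The files are divided into classes. The files of class `c` are cut into cells, one for each set of
`t c` users among the users `Z c`, and `e c` identifies a bit of such a file by its cell and its
position in that cell. -/

/-- Each user caches the cells of the sets to which the user belongs. -/
def cellPlacement {C : Type*} (cls : FileId G Nc Nu → C) (Z : C → Finset (User G L)) (t m : C → ℕ)
    (e : ∀ c, Fin B ≃ {T // T ∈ powersetCard (t c) (Z c)} × Fin (m c)) :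
    Placement G L Nc Nu B :=
  fun k => univ.filter fun p => k ∈ (e (cls p.1) p.2).1.1

theorem mem_cellPlacement {C : Type*} {cls : FileId G Nc Nu → C} {Z : C → Finset (User G L)}
    {t m : C → ℕ} {e : ∀ c, Fin B ≃ {T // T ∈ powersetCard (t c) (Z c)} × Fin (m c)}
    {f : FileId G Nc Nu} {c : C} (hc : cls f = c) {b : Fin B} {k : User G L} :
    (f, b) ∈ cellPlacement cls Z t m e k ↔ k ∈ (e c b).1.1 := by
  subst hc
  simp [cellPlacement]

/-- The sets of users served together in class `c`: those that contain a user who requests a file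
of this class. -/
def servedSets {C : Type*} [DecidableEq C] (cls : FileId G Nc Nu → C)
    (Z : C → Finset (User G L)) (t : C → ℕ) (d : Demand G L Nc Nu) (c : C) :
    Finset (Finset (User G L)) :=
  (powersetCard (t c + 1) (Z c)).filter fun S => ∃ k ∈ S, cls (requested d k) = c

/-- The unserved sets are the `(t + 1)`-subsets of the users who request nothing from the class. -/
theorem card_servedSets {C : Type*} [DecidableEq C] (cls : FileId G Nc Nu → C)
    (Z : C → Finset (User G L)) (t : C → ℕ) (d : Demand G L Nc Nu) (c : C) :
    (servedSets cls Z t d c).card +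
      ((Z c).filter fun k => cls (requested d k) ≠ c).card.choose (t c + 1) =
      (Z c).card.choose (t c + 1) := by
  rw [← card_powersetCard (t c + 1) (Z c), ← card_powersetCard, servedSets,
    ← card_filter_add_card_filter_not (s := powersetCard (t c + 1) (Z c))
      (fun S => ∃ k ∈ S, cls (requested d k) = c)]
  congr 2
  ext S
  simp only [mem_powersetCard, mem_filter, subset_iff, not_exists, not_and]
  constructor
  · rintro ⟨h1, h2⟩
    exact ⟨⟨fun k hk => (h1 hk).1, h2⟩, fun k hk => (h1 hk).2⟩
  · rintro ⟨⟨h1, h2⟩, h3⟩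
    exact ⟨fun k hk => ⟨h1 hk, h3 k hk⟩, h2⟩

theorem eq_of_decide_eq_one : ∀ x y : ZMod 2, decide (x = 1) = decide (y = 1) → x = y := by
  decide

/-- The coded multicast: for each served set `S` and each position `r`, send the sum, over the
users `k ∈ S` that request a file of the class, of the bit at `r` in the cell `S \ {k}`. -/
theorem canServe_cellPlacement {C : Type*} [Fintype C] [DecidableEq C] (cls : FileId G Nc Nu → C)
    (Z : C → Finset (User G L)) (t m : C → ℕ)
    (e : ∀ c, Fin B ≃ {T // T ∈ powersetCard (t c) (Z c)} × Fin (m c)) (d : Demand G L Nc Nu)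
    (hd : ∀ k, k ∈ Z (cls (requested d k))) :
    CanServe (cellPlacement cls Z t m e) d (∑ c, (servedSets cls Z t d c).card * m c) := by
  classical
  -- For a served set and one of its members the membership test holds, so the outer default `0` is
  -- never used there.
  let term : ∀ c, Finset (User G L) → Fin (m c) → Library G Nc Nu B → User G L → ZMod 2 :=
    fun c S r W k => if h : S.erase k ∈ powersetCard (t c) (Z c) then
      (if W (requested d k, (e c).symm (⟨S.erase k, h⟩, r)) then 1 else 0) else 0
  let enc : Library G Nc Nu B → (Σ c, {S // S ∈ servedSets cls Z t d c} × Fin (m c)) → Bool :=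
    fun W i => decide (∑ k ∈ i.2.1.1.filter (fun k => cls (requested d k) = i.1),
      term i.1 i.2.1.1 i.2.2 W k = 1)
  have hcard : Fintype.card (Σ c, {S // S ∈ servedSets cls Z t d c} × Fin (m c)) =
      ∑ c, (servedSets cls Z t d c).card * m c := by
    simp [Fintype.card_sigma, Fintype.card_prod]
  rw [← hcard]
  refine canServe_of_injOn enc fun k W W' henc hcache b => ?_
  obtain ⟨c, hc⟩ : ∃ c, cls (requested d k) = c := ⟨_, rfl⟩
  obtain ⟨⟨⟨T, hT⟩, r⟩, hb⟩ : ∃ x, e c b = x := ⟨_, rfl⟩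
  by_cases hkT : k ∈ T
  · exact hcache _ ((mem_cellPlacement hc).2 (by rwa [hb]))
  have hT' := mem_powersetCard.1 hT
  have hS : insert k T ∈ servedSets cls Z t d c := by
    refine mem_filter.2 ⟨mem_powersetCard.2 ⟨insert_subset (hc ▸ hd k) hT'.1, ?_⟩,
      k, mem_insert_self _ _, hc⟩
    rw [card_insert_of_notMem hkT, hT'.2]
  have hsum := eq_of_decide_eq_one _ _ (congrFun henc ⟨c, ⟨insert k T, hS⟩, r⟩)
  have hmem : k ∈ (insert k T).filter fun k => cls (requested d k) = c :=
    mem_filter.2 ⟨mem_insert_self _ _, hc⟩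
  dsimp only at hsum
  rw [← add_sum_erase _ _ hmem, ← add_sum_erase _ _ hmem] at hsum
  -- For `j ≠ k` the cell `S \ {j}` still contains `k`, so user `k` has cached that term and can
  -- cancel it.
  have hrest : ∀ j ∈ ((insert k T).filter fun k => cls (requested d k) = c).erase k,
      term c (insert k T) r W j = term c (insert k T) r W' j := by
    intro j hj
    obtain ⟨hjk, hj⟩ := mem_erase.1 hj
    have hjc := (mem_filter.1 hj).2
    simp only [term]
    split_ifs with h <;> try rfl
    all_goals
      have := hcache (requested d j, (e c).symm (⟨(insert k T).erase j, h⟩, r))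
        ((mem_cellPlacement hjc).2 (by simp [Ne.symm hjk]))
      simp_all
  rw [sum_congr rfl hrest, add_left_inj] at hsum
  have herase : (insert k T).erase k = T := erase_insert hkT
  have hbit : (e c).symm (⟨T, hT⟩, r) = b := by rw [← hb, Equiv.symm_apply_apply]
  simp only [term, herase, dif_pos hT, hbit] at hsum
  by_cases h1 : W (requested d k, b) <;> by_cases h2 : W' (requested d k, b) <;> simp_all

theorem load_cellPlacement_le {C : Type*} [Fintype C] [DecidableEq C] (hB : 0 < B)
    (cls : FileId G Nc Nu → C)
    (Z : C → Finset (User G L)) (t m : C → ℕ)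
    (e : ∀ c, Fin B ≃ {T // T ∈ powersetCard (t c) (Z c)} × Fin (m c)) (d : Demand G L Nc Nu)
    (hd : ∀ k, k ∈ Z (cls (requested d k))) :
    load (cellPlacement cls Z t m e) d ≤
      ∑ c, (((Z c).card.choose (t c + 1) : ℝ) -
        (((Z c).filter fun k => cls (requested d k) ≠ c).card.choose (t c + 1) : ℝ)) /
        (Z c).card.choose (t c) := by
  have hB' : (0 : ℝ) < B := by exact_mod_cast hB
  rw [load, div_le_iff₀ hB']
  refine (Nat.cast_le.2 (Nat.sInf_le (canServe_cellPlacement cls Z t m e d hd))).trans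
    (le_of_eq ?_)
  rw [sum_mul]
  push_cast
  refine sum_congr rfl fun c _ => ?_
  have h1 : ((servedSets cls Z t d c).card : ℝ) = ((Z c).card.choose (t c + 1) : ℝ) -
      (((Z c).filter fun k => cls (requested d k) ≠ c).card.choose (t c + 1) : ℝ) := by
    rw [← card_servedSets cls Z t d c]; push_cast; ring
  have h2 : (B : ℝ) = (Z c).card.choose (t c) * m c := by
    have := Fintype.card_congr (e c)
    rw [Fintype.card_fin, Fintype.card_prod, Fintype.card_coe, card_powersetCard,
      Fintype.card_fin] at this
    exact_mod_cast this
  rw [← h1, h2]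
  have h3 : ((Z c).card.choose (t c) : ℝ) ≠ 0 := by
    intro h0
    rw [h0, zero_mul] at h2
    exact hB'.ne' h2
  field_simp

theorem card_subfile_cellPlacement {C : Type*} (cls : FileId G Nc Nu → C)
    (Z : C → Finset (User G L)) (t m : C → ℕ)
    (e : ∀ c, Fin B ≃ {T // T ∈ powersetCard (t c) (Z c)} × Fin (m c)) (f : FileId G Nc Nu)
    (T : Finset (User G L)) :
    (subfile (cellPlacement cls Z t m e) f T).card * (Z (cls f)).card.choose (t (cls f)) =
      if T ∈ powersetCard (t (cls f)) (Z (cls f)) then B else 0 := by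
  classical
  have hsub : subfile (cellPlacement cls Z t m e) f T =
      univ.filter fun b => (e (cls f) b).1.1 = T := by
    ext b
    simp [subfile, cellPlacement, Finset.ext_iff]
  rw [hsub]
  split_ifs with hT
  · have hc : (univ.filter fun b => (e (cls f) b).1.1 = T).card = m (cls f) := by
      refine Eq.trans (Eq.symm ?_) (card_fin (m (cls f)))
      refine card_bij (fun r _ => (e (cls f)).symm (⟨T, hT⟩, r)) ?_ ?_ ?_
      · intro r _; simp
      · intro r _ r' _ h; simpa using h
      · intro b hb
        refine ⟨(e (cls f) b).2, mem_univ _, ?_⟩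
        rw [Equiv.symm_apply_eq]
        exact Prod.ext (Subtype.ext (mem_filter.1 hb).2.symm) rfl
    have := Fintype.card_congr (e (cls f))
    rw [Fintype.card_fin, Fintype.card_prod, Fintype.card_coe, card_powersetCard,
      Fintype.card_fin] at this
    rw [hc, this, mul_comm]
  · rw [filter_false_of_mem, card_empty, zero_mul]
    rintro b - rfl
    exact hT (e (cls f) b).1.2

/-- The fraction `t / n` of the `t`-element subsets of an `n`-element set contain a given point. -/
theorem card_filter_mem_powersetCard_mul {U : Type*} [DecidableEq U] (Z : Finset U) (t : ℕ) {k : U}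
    (hk : k ∈ Z) :
    ((powersetCard t Z).filter fun T => k ∈ T).card * Z.card = t * Z.card.choose t := by
  rcases t with _ | t
  · rw [filter_false_of_mem]
    · simp
    · intro T hT
      simp_all
  · have h : ((powersetCard (t + 1) Z).filter fun T => k ∈ T).card =
        (powersetCard t (Z.erase k)).card := by
      refine card_bij' (fun T _ => T.erase k) (fun T _ => insert k T) ?_ ?_ ?_ ?_
      · intro T hT
        simp only [mem_filter, mem_powersetCard] at hT ⊢
        exact ⟨erase_subset_erase _ hT.1.1, by rw [card_erase_of_mem hT.2, hT.1.2]; rfl⟩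
      · intro T hT
        simp only [mem_filter, mem_powersetCard] at hT ⊢
        refine ⟨⟨insert_subset hk (hT.1.trans (erase_subset _ _)), ?_⟩, mem_insert_self _ _⟩
        rw [card_insert_of_notMem fun h => notMem_erase k Z (hT.1 h), hT.2]
      · intro T hT
        exact insert_erase (mem_filter.1 hT).2
      · intro T hT
        exact erase_insert fun h => notMem_erase k Z ((mem_powersetCard.1 hT).1 h)
    obtain ⟨n, hn⟩ : ∃ n, Z.card = n + 1 := ⟨Z.card - 1, by have := card_pos.2 ⟨k, hk⟩; omega⟩
    rw [h, card_powersetCard, card_erase_of_mem hk, hn, Nat.add_sub_cancel, mul_comm,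
      Nat.add_one_mul_choose_eq, mul_comm]

theorem card_cached_mul {Z : Finset (User G L)} {t m : ℕ}
    (e : Fin B ≃ {T // T ∈ powersetCard t Z} × Fin m) (k : User G L) :
    (univ.filter fun b => k ∈ (e b).1.1).card * Z.card = if k ∈ Z then t * B else 0 := by
  classical
  have h1 : (univ.filter fun b => k ∈ (e b).1.1).card =
      ((powersetCard t Z).filter fun T => k ∈ T).card * m := by
    refine Eq.trans ?_ (Eq.trans (card_product ((powersetCard t Z).filter fun T => k ∈ T)
      (univ : Finset (Fin m))) (by rw [card_fin]))
    refine card_bij (fun b _ => ((e b).1.1, (e b).2)) ?_ ?_ ?_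
    · intro b hb
      exact mem_product.2 ⟨mem_filter.2 ⟨(e b).1.2, (mem_filter.1 hb).2⟩, mem_univ _⟩
    · intro b _ b' _ h
      obtain ⟨h1, h2⟩ := Prod.mk.inj h
      exact e.injective (Prod.ext (Subtype.ext h1) h2)
    · rintro ⟨T, r⟩ h
      obtain ⟨hT, hk⟩ := mem_filter.1 (mem_product.1 h).1
      exact ⟨e.symm (⟨T, hT⟩, r), by simpa using hk, by simp⟩
  have h2 := Fintype.card_congr e
  rw [Fintype.card_fin, Fintype.card_prod, Fintype.card_coe, card_powersetCard,
    Fintype.card_fin] at h2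
  rw [h1]
  split_ifs with hk
  · rw [mul_right_comm, card_filter_mem_powersetCard_mul Z t hk, h2, mul_assoc]
  · rw [filter_false_of_mem, card_empty, zero_mul, zero_mul]
    exact fun T hT h => hk ((mem_powersetCard.1 hT).1 h)

/-! ### The scheme that separates common and unique files -/

/-- The class of a file: `none` for the common files, and `some g` for the files of group `g`. -/
def fileClass : FileId G Nc Nu → Option (Fin G) :=
  Sum.elim (fun _ => none) fun x => some x.1

/-- The users that may request the files of a class. -/
def classUsers (G L : ℕ) : Option (Fin G) → Finset (User G L)
  | none => univ
  | some g => univ.filter fun k => k.1 = g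

/-- The number of users that cache each cell of the files of a class. -/
def classShare (G tc tu : ℕ) : Option (Fin G) → ℕ
  | none => tc
  | some _ => tu

/-- The size of the cells of the files of a class. -/
def cellSize (G L tc tu : ℕ) : Option (Fin G) → ℕ
  | none => L.choose tu
  | some _ => (G * L).choose tc

theorem card_classUsers_none : (classUsers G L none).card = G * L := by
  simp [classUsers]

theorem card_classUsers_some (g : Fin G) : (classUsers G L (some g)).card = L := by
  have : classUsers G L (some g) = univ.image fun l : Fin L => (g, l) := by
    ext ⟨g', l⟩
    simp [classUsers, eq_comm]
  rw [this, card_image_of_injective _ (Prod.mk_right_injective g), card_fin]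

theorem mem_classUsers_requested (d : Demand G L Nc Nu) (k : User G L) :
    k ∈ classUsers G L (fileClass (requested d k)) := by
  rcases h : d k with n | n <;> simp [requested, h, fileClass, classUsers]

theorem fileClass_requested_ne_some {d : Demand G L Nc Nu} {k : User G L} {g : Fin G}
    (hk : k.1 = g) : fileClass (requested d k) ≠ some g ↔ fileClass (requested d k) = none := by
  rcases h : d k with n | n <;> simp [requested, h, fileClass, hk]

/-- One file size must be divisible by both cell counts. `B` is their product, so the cell size in
one kind of class is the cell count of the other. -/
theorem nonempty_cellEquiv (G L tc tu : ℕ) (c : Option (Fin G)) :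
    Nonempty (Fin ((G * L).choose tc * L.choose tu) ≃
      {T // T ∈ powersetCard (classShare G tc tu c) (classUsers G L c)} ×
        Fin (cellSize G L tc tu c)) := by
  refine ⟨Fintype.equivOfCardEq ?_⟩
  rw [Fintype.card_fin, Fintype.card_prod, Fintype.card_coe, card_powersetCard, Fintype.card_fin]
  cases c with
  | none => rw [card_classUsers_none]; rfl
  | some g => rw [card_classUsers_some, mul_comm]; rfl

/-- The placement of the scheme. -/
noncomputable def separatePlacement (G L Nc Nu tc tu : ℕ) :
    Placement G L Nc Nu ((G * L).choose tc * L.choose tu) :=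
  cellPlacement fileClass (classUsers G L) (classShare G tc tu) (cellSize G L tc tu)
    fun c => (nonempty_cellEquiv G L tc tu c).some

theorem isSeparatePlacement_separatePlacement (G L Nc Nu tc tu : ℕ) :
    IsSeparatePlacement (separatePlacement G L Nc Nu tc tu) tc tu := by
  refine ⟨fun n T => ?_, fun g n T => ?_⟩
  · have h := card_subfile_cellPlacement fileClass (classUsers G L) (classShare G tc tu)
      (cellSize G L tc tu) (fun c => (nonempty_cellEquiv G L tc tu c).some)
      (Sum.inl n : FileId G Nc Nu) T
    have hc : fileClass (Sum.inl n : FileId G Nc Nu) = none := rfl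
    rw [hc, card_classUsers_none] at h
    refine h.trans (if_congr ?_ rfl rfl)
    simp [mem_powersetCard, classUsers, classShare]
  · have h := card_subfile_cellPlacement fileClass (classUsers G L) (classShare G tc tu)
      (cellSize G L tc tu) (fun c => (nonempty_cellEquiv G L tc tu c).some)
      (Sum.inr (g, n) : FileId G Nc Nu) T
    have hc : fileClass (Sum.inr (g, n) : FileId G Nc Nu) = some g := rfl
    rw [hc, card_classUsers_some] at h
    refine h.trans (if_congr ?_ rfl rfl)
    simp [mem_powersetCard, classUsers, classShare, subset_iff, and_comm]

/-- A user stores the fraction `tc / (G * L)` of each common file, `tu / L` of each unique file of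
the own group, and nothing of other groups. -/
theorem card_separatePlacement (hG : 0 < G) (hL : 0 < L) (tc tu : ℕ) (k : User G L) :
    ((separatePlacement G L Nc Nu tc tu k).card : ℝ) =
      (Nc * (tc / (G * L)) + Nu * (tu / L)) * ((G * L).choose tc * L.choose tu : ℕ) := by
  have hG' : (0 : ℝ) < G := by exact_mod_cast hG
  have hL' : (0 : ℝ) < L := by exact_mod_cast hL
  let e := fun c => (nonempty_cellEquiv G L tc tu c).some
  have hsplit : (separatePlacement G L Nc Nu tc tu k).card =
      ∑ f : FileId G Nc Nu, (univ.filter fun b => k ∈ (e (fileClass f) b).1.1).card := by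
    simp_rw [card_filter]
    rw [separatePlacement, cellPlacement, card_filter, Fintype.sum_prod_type]
  have hcommon : ∀ n : Fin Nc, ((univ.filter fun b =>
      k ∈ (e (fileClass (Sum.inl n : FileId G Nc Nu)) b).1.1).card : ℝ) =
      tc / (G * L) * ((G * L).choose tc * L.choose tu : ℕ) := by
    intro n
    have h := card_cached_mul (e none) k
    rw [card_classUsers_none, if_pos (show k ∈ classUsers G L none from mem_univ k)] at h
    have h' : ((univ.filter fun b => k ∈ (e none b).1.1).card : ℝ) * (G * L) =
        tc * ((G * L).choose tc * L.choose tu : ℕ) := by exact_mod_cast h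
    rw [div_mul_eq_mul_div, eq_div_iff (by positivity)]
    exact h'
  have hunique : ∀ (g : Fin G) (n : Fin Nu), ((univ.filter fun b =>
      k ∈ (e (fileClass (Sum.inr (g, n) : FileId G Nc Nu)) b).1.1).card : ℝ) =
      if k.1 = g then tu / L * (((G * L).choose tc * L.choose tu : ℕ) : ℝ) else 0 := by
    intro g n
    have h := card_cached_mul (e (some g)) k
    rw [card_classUsers_some] at h
    have hmem : k ∈ classUsers G L (some g) ↔ k.1 = g := by simp [classUsers]
    simp only [hmem] at h
    have h' : ((univ.filter fun b => k ∈ (e (some g) b).1.1).card : ℝ) * L =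
        if k.1 = g then tu * (((G * L).choose tc * L.choose tu : ℕ) : ℝ) else 0 := by
      split_ifs at h ⊢ <;> exact_mod_cast h
    rw [show (if k.1 = g then tu / L * (((G * L).choose tc * L.choose tu : ℕ) : ℝ) else 0) =
      (if k.1 = g then tu * (((G * L).choose tc * L.choose tu : ℕ) : ℝ) else 0) / L by
        split_ifs <;> ring, eq_div_iff hL'.ne']
    exact h'
  rw [hsplit, Nat.cast_sum, Fintype.sum_sum_type, Fintype.sum_prod_type]
  simp_rw [hcommon, hunique]
  rw [sum_comm]
  simp_rw [sum_ite_eq, mem_univ, if_true, sum_const, card_univ, Fintype.card_fin, nsmul_eq_mul]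
  ring

theorem fitsMemory_separatePlacement (hG : 0 < G) (hL : 0 < L) (hNc : 0 < Nc) (hNu : 0 < Nu)
    {M β : ℝ} {tc tu : ℕ} (hc : (tc : ℝ) = tCommon G L Nc M β)
    (hu : (tu : ℝ) = tUnique G L Nu M β) :
    FitsMemory (separatePlacement G L Nc Nu tc tu) M := by
  intro k
  have hG' : (0 : ℝ) < G := by exact_mod_cast hG
  have hL' : (0 : ℝ) < L := by exact_mod_cast hL
  have hNc' : (0 : ℝ) < Nc := by exact_mod_cast hNc
  have hNu' : (0 : ℝ) < Nu := by exact_mod_cast hNu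
  rw [card_separatePlacement hG hL, hc, hu]
  refine le_of_eq (congrArg (· * _) ?_)
  unfold tCommon tUnique
  field_simp
  ring

theorem load_separatePlacement_le (hG : 0 < G) {M β : ℝ}
    (hM : 0 ≤ M) (hβ0 : 0 ≤ β) (hβ1 : β ≤ 1) {tc tu : ℕ} (htc : tc ≤ G * L) (htu : tu ≤ L)
    (hc : (tc : ℝ) = tCommon G L Nc M β) (hu : (tu : ℝ) = tUnique G L Nu M β)
    (d : Demand G L Nc Nu) :
    load (separatePlacement G L Nc Nu tc tu) d ≤ schemeWorst G L Nc Nu M β := by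
  classical
  have hG' : (0 : ℝ) < G := by exact_mod_cast hG
  have hload := load_cellPlacement_le
    (Nat.mul_pos (Nat.choose_pos htc) (Nat.choose_pos htu)) fileClass (classUsers G L)
    (classShare G tc tu) (cellSize G L tc tu)
    (fun c => (nonempty_cellEquiv G L tc tu c).some) d (mem_classUsers_requested d)
  rw [Fintype.sum_option] at hload
  simp_rw [card_classUsers_none, card_classUsers_some] at hload
  dsimp only [classShare] at hload
  set a := ((classUsers G L none).filter fun k => fileClass (requested d k) ≠ none).card with ha
  set p : Fin G → ℕ := fun g =>
    ((classUsers G L (some g)).filter fun k => fileClass (requested d k) ≠ some g).card with hp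
  -- Here `a` counts the users with unique requests and `p g` the users of group `g` with common
  -- requests.
  have hsum : a + ∑ g, p g = G * L := by
    have h : ∑ g, p g = (univ.filter fun k => ¬ fileClass (requested d k) ≠ none).card := by
      rw [card_eq_sum_card_fiberwise (f := fun k : User G L => k.1) (t := univ)
        (fun _ _ => mem_univ _)]
      refine sum_congr rfl fun g _ => congrArg card ?_
      ext k
      simp only [classUsers, mem_filter, mem_univ, true_and, not_not]
      rw [and_comm]
      exact and_congr_left fun hk => fileClass_requested_ne_some hk
    rw [h, ha]
    simp only [classUsers]
    rw [card_filter_add_card_filter_not]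
    simp
  have hsumR : (a : ℝ) + ∑ g, (p g : ℝ) = G * L := by exact_mod_cast hsum
  have hp0 : 0 ≤ ∑ g, (p g : ℝ) := sum_nonneg fun _ _ => Nat.cast_nonneg _
  have hα : (a / G : ℝ) ∈ Set.Icc (0 : ℝ) L :=
    ⟨by positivity, by rw [div_le_iff₀ hG']; linarith⟩
  -- With `α = a / G`, the `p g` average to `L - α`. Evening them out can only shrink the subtracted
  -- binomials, hence raise the load bound.
  have hjensen := card_mul_gchoose_average_le (univ : Finset (Fin G)) ⟨⟨0, hG⟩, mem_univ _⟩ p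
    (Nat.succ_ne_zero tu) (x := L - a / G) (by
      rw [card_fin, mul_sub, mul_div_cancel₀ _ hG'.ne']; linarith)
  rw [card_fin] at hjensen
  refine hload.trans (le_trans ?_ (schemeLoad_le_schemeWorst hG hM hβ0 hβ1 hα))
  have hGL : (G * L : ℝ) = ((G * L : ℕ) : ℝ) := by push_cast; rfl
  rw [schemeLoad, ← hc, ← hu, mul_div_cancel₀ _ hG'.ne', hGL, ← Nat.cast_succ, ← Nat.cast_succ,
    gchoose_natCast, gchoose_natCast, gchoose_natCast, gchoose_natCast, gchoose_natCast]
  refine add_le_add le_rfl ?_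
  rw [← sum_div, mul_div_assoc']
  refine div_le_div_of_nonneg_right ?_ (Nat.cast_nonneg _)
  rw [sum_sub_distrib, sum_const, card_univ, Fintype.card_fin, nsmul_eq_mul, mul_sub]
  exact sub_le_sub_left hjensen _

end CodedCaching

theorem theorem2 (G L Nc Nu : ℕ) (hG : 0 < G) (hL : 0 < L) (hNc : G * L ≤ Nc) (hNu : L ≤ Nu)
    (M : ℝ) (hM0 : 0 ≤ M) (hM1 : M ≤ Nc + Nu) :
    -- the load of the scheme is within a factor 2 of the optimum, on the whole memory range
    CodedCaching.achievableLoad G L Nc Nu M ≤ 2 * CodedCaching.optimalLoad G L Nc Nu M ∧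
    -- and the scheme attains the load that the formula gives, where its parameters are integers
    (∀ β : ℝ, 0 ≤ β → β ≤ 1 → ∀ tc tu : ℕ, tc ≤ G * L → tu ≤ L →
      (tc : ℝ) = CodedCaching.tCommon G L Nc M β → (tu : ℝ) = CodedCaching.tUnique G L Nu M β →
      (∃ B : ℕ, 0 < B ∧ ∃ χ : CodedCaching.Placement G L Nc Nu B,
        CodedCaching.IsSeparatePlacement χ tc tu ∧ CodedCaching.FitsMemory χ M ∧
        CodedCaching.worstLoad χ ≤ CodedCaching.schemeWorst G L Nc Nu M β) ∧
      CodedCaching.optimalLoad G L Nc Nu M ≤ CodedCaching.schemeWorst G L Nc Nu M β) := by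
  refine ⟨CodedCaching.achievableLoad_le_two_mul_optimalLoad hG hL hNc hNu hM0, ?_⟩
  intro β hβ0 hβ1 tc tu htc htu hc hu
  have hB := Nat.mul_pos (Nat.choose_pos htc) (Nat.choose_pos htu)
  have hfits := CodedCaching.fitsMemory_separatePlacement hG hL
    (lt_of_lt_of_le (Nat.mul_pos hG hL) hNc) (lt_of_lt_of_le hL hNu) hc hu
  have hworst : CodedCaching.worstLoad (CodedCaching.separatePlacement G L Nc Nu tc tu) ≤
      CodedCaching.schemeWorst G L Nc Nu M β :=
    Real.iSup_le (fun d => CodedCaching.load_separatePlacement_le hG hM0 hβ0 hβ1 htc htu hc hu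
      d.1) (CodedCaching.schemeWorst_nonneg hG hM0 hβ0 hβ1)
  exact ⟨⟨_, hB, _, CodedCaching.isSeparatePlacement_separatePlacement G L Nc Nu tc tu, hfits,
    hworst⟩, (CodedCaching.optimalLoad_le_worstLoad hB _ hfits).trans hworst⟩
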